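/- Let $\mathcal C$ be a locally presentable category and $F\colon\mathcal C\to\mathcal C$ an accessible endofunctor. Then there is a regular cardinal $\lambda$ such that $\mathcal C$ is locally $\lambda$-presentable and $F$ is $\lambda$-accessible (i.e. preserves $\lambda$-filtered colimits). Moreover, the following holds for every such $\lambda$. Call an $F$-coalgebra $r\colon R\to FR$ recursive if for every $F$-algebra $a\colon FA\to A$ there is exactly one morphism $s\colon R\to A$ with $s=a\circ Fs\circ r$. Let $D\colon \mathcal R_\lambda\hookrightarrow F\text{-}\mathsf{Coalg}$ be the inclusion of the full subcategory of all recursive coalgebras whose carrier is a $\lambda$-presentable object of $\mathcal C$, and let $V\colon F\text{-}\mathsf{Coalg}\to\mathcal C$ be the forgetful functor. Then: 1. $F$ has an initial algebra, and the colimits of $D$ and of $V\circ D$ exist. 2. Every colimit cocone of $D$ is sent by $V$ to a colimit cocone of $V\circ D$, and if $(A,\alpha)$ is a colimit of $D$, then $\alpha\colon A\to FA$ is an isomorphism and $(A,\alpha^{-1})$ is an initial $F$-algebra. 3. Conversely, for every initial $F$-algebra $(I,\iota)$, the structure $\iota$ is an isomorphism, and the coalgebra $(I,\iota^{-1})$ carries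 a cocone on $D$ that is a colimit of $D$ and whose image under $V$ is a colimit of $V\circ D$. -/

import Mathlib

open CategoryTheory CategoryTheory.Limits CategoryTheory.Endofunctor

universe w v u

namespace RecCoalg

variable {C : Type u} [Category.{v} C] {F : C ⥤ C}

/-- A morphism `s : D ⟶ A` in `C` is a coalgebra-to-algebra morphism from the coalgebra `(D, d)` to
the algebra `(A, a)` if `s = a ∘ F s ∘ d`. -/
def IsCoalgToAlg (D : Coalgebra F) (A : Algebra F) (s : D.V ⟶ A.a) : Prop :=
  s = D.str ≫ F.map s ≫ A.str

/-- A coalgebra is recursive if it has exactly one coalgebra-to-algebra morphism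
to every algebra. -/
def IsRecursive (R : Coalgebra F) : Prop :=
  ∀ A : Algebra F, ∃! s : R.V ⟶ A.a, IsCoalgToAlg R A s

variable (F) in
/-- The property of being a recursive coalgebra with a `κ`-presentable carrier. -/
def finRec (κ : Cardinal.{w}) [Fact κ.IsRegular] : ObjectProperty (Coalgebra F) :=
  fun R ↦ IsCardinalPresentable R.V κ ∧ IsRecursive R

variable (F) in
/-- The diagram of all recursive coalgebras with a `κ`-presentable carrier: the inclusion into
`F`-coalgebras of the full subcategory that they span. -/
abbrev finRecDiagram (κ : Cardinal.{w}) [Fact κ.IsRegular] :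
    (finRec F κ).FullSubcategory ⥤ Coalgebra F :=
  (finRec F κ).ι

/-- An algebra with invertible structure, regarded as a coalgebra. -/
noncomputable abbrev coalgOfAlg (A : Algebra F) [IsIso A.str] : Coalgebra F :=
  ⟨A.a, inv A.str⟩

/-- A coalgebra with invertible structure, regarded as an algebra. -/
noncomputable abbrev algOfCoalg (R : Coalgebra F) [IsIso R.str] : Algebra F :=
  ⟨R.V, inv R.str⟩

end RecCoalg

/-! Let A be the colimit of all recursive coalgebras with λ-presentable carrier, formed on carriers.
Recursive coalgebras are closed under such colimits, so A is recursive; once its structure α is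
invertible, recursiveness says exactly that the inverse is an initial algebra. Invertibility is
tested on maps from a strong generator of λ-presentable objects P. The diagram is λ-filtered and F
preserves its colimit, so a map P ⟶ FA factors through some FR, and the recursive coalgebra P ⨿ R
lifts it to A (`exists_lift_comp_str`). If α identifies two maps P ⟶ A, they already have equal
composites with the structure of some R, and a recursive coequalizer of R merges them
(`comp_str_injective`). -/

namespace RecCoalg

variable {C : Type u} [Category.{v} C] {F : C ⥤ C}

section Colimits

variable {J : Type*} [Category* J] {D : J ⥤ Coalgebra F}

/-- The cocone on the carriers of a diagram of coalgebras that is induced by their structures. -/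
def strCocone (c : Cocone (D ⋙ Coalgebra.forget F)) : Cocone (D ⋙ Coalgebra.forget F) where
  pt := F.obj c.pt
  ι :=
    { app := fun j ↦ (D.obj j).str ≫ F.map (c.ι.app j)
      naturality := fun i j f ↦ by
        let a (k : J) : (D.obj k).V ⟶ c.pt := c.ι.app k
        have h : (D.map f).f ≫ a j = a i := c.w f
        change (D.map f).f ≫ (D.obj j).str ≫ F.map (a j) =
          ((D.obj i).str ≫ F.map (a i)) ≫ 𝟙 (F.obj c.pt)
        rw [Category.comp_id, ← h, F.map_comp, Coalgebra.Hom.h_assoc] }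

/-- A colimit cocone of carriers lifts to a cocone of coalgebras. -/
def liftCocone {c : Cocone (D ⋙ Coalgebra.forget F)} (hc : IsColimit c) : Cocone D where
  pt := ⟨c.pt, hc.desc (strCocone c)⟩
  ι :=
    { app := fun j ↦ ⟨c.ι.app j, (hc.fac (strCocone c) j).symm⟩
      naturality := fun i j f ↦ by
        ext
        exact c.ι.naturality f }

/-- A cocone of coalgebras is a colimit cocone if its underlying cocone is. -/
def isColimitOfForget {c : Cocone D} (hc : IsColimit ((Coalgebra.forget F).mapCocone c)) :
    IsColimit c where
  desc s :=
    { f := hc.desc ((Coalgebra.forget F).mapCocone s)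
      h := by
        refine hc.hom_ext fun j ↦ ?_
        let d : c.pt.V ⟶ s.pt.V := hc.desc ((Coalgebra.forget F).mapCocone s)
        let a : D.obj j ⟶ c.pt := c.ι.app j
        let b : D.obj j ⟶ s.pt := s.ι.app j
        have h : a.f ≫ d = b.f := hc.fac ((Coalgebra.forget F).mapCocone s) j
        change a.f ≫ c.pt.str ≫ F.map d = a.f ≫ d ≫ s.pt.str
        rw [reassoc_of% h, ← Coalgebra.Hom.h_assoc, ← F.map_comp, h, Coalgebra.Hom.h] }
  fac s j := by
    ext
    exact hc.fac ((Coalgebra.forget F).mapCocone s) j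
  uniq s m hm := by
    ext
    exact hc.uniq ((Coalgebra.forget F).mapCocone s) m.f fun j ↦
      congr_arg Coalgebra.Hom.f (hm j)

lemma hasColimit_of_hasColimit_forget [HasColimit (D ⋙ Coalgebra.forget F)] : HasColimit D :=
  ⟨⟨_, isColimitOfForget (c := liftCocone (colimit.isColimit (D ⋙ Coalgebra.forget F)))
    (colimit.isColimit (D ⋙ Coalgebra.forget F))⟩⟩

lemma nonempty_isColimit_forget [HasColimit (D ⋙ Coalgebra.forget F)] {c : Cocone D}
    (hc : IsColimit c) : Nonempty (IsColimit ((Coalgebra.forget F).mapCocone c)) := by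
  let hc₀ := colimit.isColimit (D ⋙ Coalgebra.forget F)
  have : PreservesColimit D (Coalgebra.forget F) :=
    preservesColimit_of_preserves_colimit_cocone (isColimitOfForget (c := liftCocone hc₀) hc₀) hc₀
  exact ⟨isColimitOfPreserves _ hc⟩

end Colimits

/-! ### Closure properties of recursive coalgebras -/

lemma IsCoalgToAlg.precomp {R S : Coalgebra F} {A : Algebra F} (f : R ⟶ S) {s : S.V ⟶ A.a}
    (hs : IsCoalgToAlg S A s) : IsCoalgToAlg R A (f.f ≫ s) := by
  unfold IsCoalgToAlg at hs ⊢
  rw [F.map_comp, Category.assoc, Coalgebra.Hom.h_assoc, ← hs]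

lemma IsRecursive.hom_ext {R : Coalgebra F} (hR : IsRecursive R) {A : Algebra F} {s t : R.V ⟶ A.a}
    (hs : IsCoalgToAlg R A s) (ht : IsCoalgToAlg R A t) : s = t :=
  (hR A).unique hs ht

/-- Uniqueness of the solutions on the objects of the diagram makes them compatible, so they glue.
-/
lemma isRecursive_of_isColimit {J : Type*} [Category* J] {D : J ⥤ Coalgebra F} {c : Cocone D}
    (hc : IsColimit ((Coalgebra.forget F).mapCocone c)) (hD : ∀ j, IsRecursive (D.obj j)) :
    IsRecursive c.pt := by
  intro A
  choose s hs using fun j ↦ (hD j A).exists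
  let t : Cocone (D ⋙ Coalgebra.forget F) :=
    { pt := A.a
      ι :=
        { app := s
          naturality := fun i j f ↦
            ((hD i).hom_ext ((hs j).precomp (D.map f)) (hs i)).trans (Category.comp_id _).symm } }
  let d : c.pt.V ⟶ A.a := hc.desc t
  have ht (j : J) : (c.ι.app j).f ≫ d = s j := hc.fac t j
  refine ⟨d, hc.hom_ext fun j ↦ ?_, fun u hu ↦ hc.hom_ext fun j ↦ ?_⟩
  · let a : D.obj j ⟶ c.pt := c.ι.app j
    change a.f ≫ d = a.f ≫ c.pt.str ≫ F.map d ≫ A.str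
    rw [← Coalgebra.Hom.h_assoc, ← F.map_comp_assoc, ht]
    exact hs j
  · exact ((hD j).hom_ext (hu.precomp (c.ι.app j)) (hs j)).trans (ht j).symm

/-- A recursive coalgebra with invertible structure is an initial algebra. -/
noncomputable def IsRecursive.isInitial {R : Coalgebra F} [IsIso R.str] (hR : IsRecursive R) :
    IsInitial (algOfCoalg R) :=
  IsInitial.ofUniqueHom
    (fun A ↦
      { f := (hR A).choose
        h := by
          have h : IsCoalgToAlg R A (hR A).choose := (hR A).choose_spec.1
          exact ((IsIso.inv_comp_eq R.str).2 h).symm })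
    (fun A m ↦ by
      ext
      exact (hR A).choose_spec.2 m.f ((IsIso.inv_comp_eq R.str).1 m.h.symm))

/-- A morphism `P ⟶ F R` extends the structure of a coalgebra `R` to `P ⨿ R`. -/
noncomputable abbrev coprodCoalgebra (R : Coalgebra F) {P : C} (p : P ⟶ F.obj R.V)
    [HasBinaryCoproduct P R.V] : Coalgebra F where
  V := P ⨿ R.V
  str := coprod.desc p R.str ≫ F.map coprod.inr

/-- The structure factors through F R, so a solution's restriction to R determines its component on
P. -/
lemma IsRecursive.coprodCoalgebra {R : Coalgebra F} (hR : IsRecursive R) {P : C}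
    (p : P ⟶ F.obj R.V) [HasBinaryCoproduct P R.V] :
    IsRecursive (coprodCoalgebra R p) := by
  intro A
  obtain ⟨s, hs, hs'⟩ := hR A
  refine ⟨coprod.desc (p ≫ F.map s ≫ A.str) s, ?_, fun (t : P ⨿ R.V ⟶ A.a) ht ↦ ?_⟩
  · change coprod.desc (p ≫ F.map s ≫ A.str) s = (coprod.desc p R.str ≫ F.map coprod.inr) ≫
      F.map (coprod.desc (p ≫ F.map s ≫ A.str) s) ≫ A.str
    refine coprod.hom_ext ?_ ?_
    · rw [Category.assoc, coprod.inl_desc, coprod.inl_desc_assoc, ← F.map_comp_assoc,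
        coprod.inr_desc]
    · rw [Category.assoc, coprod.inr_desc, coprod.inr_desc_assoc, ← F.map_comp_assoc,
        coprod.inr_desc]
      exact hs
  · change t = (coprod.desc p R.str ≫ F.map coprod.inr) ≫ F.map t ≫ A.str at ht
    have h : coprod.inr ≫ t = s := hs' _ <|
      calc
        coprod.inr ≫ t = _ := congr_arg (coprod.inr ≫ ·) ht
        _ = R.str ≫ F.map (coprod.inr ≫ t) ≫ A.str := by
          rw [Category.assoc, coprod.inr_desc_assoc, F.map_comp_assoc]
    refine coprod.hom_ext ?_ (by rw [h, coprod.inr_desc])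
    rw [coprod.inl_desc, ht, Category.assoc, coprod.inl_desc_assoc, ← F.map_comp_assoc, h]

/-- The coequalizer of two morphisms identified by the structure of a coalgebra `R` carries a
quotient coalgebra of `R`. -/
noncomputable abbrev coequalizerCoalgebra (R : Coalgebra F) {P : C} {f g : P ⟶ R.V}
    (h : f ≫ R.str = g ≫ R.str) [HasCoequalizer f g] : Coalgebra F where
  V := coequalizer f g
  str := coequalizer.desc R.str h ≫ F.map (coequalizer.π f g)

lemma IsRecursive.coequalizerCoalgebra {R : Coalgebra F} (hR : IsRecursive R) {P : C}
    {f g : P ⟶ R.V} (h : f ≫ R.str = g ≫ R.str) [HasCoequalizer f g] :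
    IsRecursive (coequalizerCoalgebra R h) := by
  intro A
  obtain ⟨s, hs, hs'⟩ := hR A
  -- A solution factors through the structure of R, which already identifies f and g.
  have hfg : f ≫ s = g ≫ s := by
    rw [hs, reassoc_of% h]
  refine ⟨coequalizer.desc s hfg, ?_, fun t ht ↦ ?_⟩
  · change coequalizer.desc s hfg = (coequalizer.desc R.str h ≫ F.map (coequalizer.π f g)) ≫
      F.map (coequalizer.desc s hfg) ≫ A.str
    ext
    rw [Category.assoc, coequalizer.π_desc, coequalizer.π_desc_assoc, ← F.map_comp_assoc,
      coequalizer.π_desc]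
    exact hs
  · ext
    rw [coequalizer.π_desc]
    refine hs' _ ?_
    have := congr_arg (coequalizer.π f g ≫ ·) ht
    simpa [IsCoalgToAlg] using this

lemma isIso_of_bijective_comp {P : ObjectProperty C} (hP : P.IsStrongGenerator) {X Y : C}
    (f : X ⟶ Y) (hf : ∀ G, P G → Function.Bijective (fun g : G ⟶ X ↦ g ≫ f)) : IsIso f := by
  have : Mono f := ⟨fun a b hab ↦ hP.isSeparating _ _ fun G hG g ↦
    (hf G hG).1 (by simp [hab])⟩
  exact hP.isIso_of_mono f fun G hG ↦ (hf G hG).2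

/-! ### The λ-filtered diagram and the invertibility of its colimit's structure -/

section Presentable

instance locallySmall_coalgebra (F : C ⥤ C) [LocallySmall.{w} C] :
    LocallySmall.{w} (Coalgebra F) :=
  locallySmall_of_faithful (Coalgebra.forget F)

variable (F) (κ : Cardinal.{w}) [Fact κ.IsRegular] [IsCardinalLocallyPresentable C κ]

/-- Carriers form a small set up to isomorphism, and each admits only a small set of structures. -/
instance essentiallySmall_finRec : ObjectProperty.EssentiallySmall.{w} (finRec F κ) := by
  obtain ⟨Q, _, -, hQ⟩ :=
    ObjectProperty.EssentiallySmall.exists_small_le.{w} (isCardinalPresentable C κ)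
  let S : ObjectProperty (Coalgebra F) := fun R ↦ Q R.V
  have : Small.{w} (Subtype Q) := inferInstanceAs (ObjectProperty.Small.{w} Q)
  have : ObjectProperty.Small.{w} S :=
    small_of_surjective (α := Σ X : Subtype Q, (X.1 ⟶ F.obj X.1))
      (f := fun x ↦ ⟨⟨x.1.1, x.2⟩, x.1.2⟩)
      (fun R ↦ ⟨⟨⟨R.1.V, R.2⟩, R.1.str⟩, rfl⟩)
  refine ⟨S, inferInstance, fun R hR ↦ ?_⟩
  obtain ⟨X, hX, ⟨e⟩⟩ := hQ R.V hR.1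
  exact ⟨⟨X, e.inv ≫ R.str ≫ F.map e.hom⟩, hX, ⟨Coalgebra.isoMk e (by simp)⟩⟩

instance isCardinalFiltered_finRec : IsCardinalFiltered (finRec F κ).FullSubcategory κ where
  nonempty_cocone {A _} G hA := by
    let D := G ⋙ finRecDiagram F κ
    let hc := colimit.isColimit (D ⋙ Coalgebra.forget F)
    have (a : A) : IsCardinalPresentable ((D ⋙ Coalgebra.forget F).obj a) κ :=
      (G.obj a).property.1
    have h : finRec F κ (liftCocone hc).pt :=
      ⟨isCardinalPresentable_of_isColimit _ hc κ hA,
        isRecursive_of_isColimit (c := liftCocone hc) hc fun a ↦ (G.obj a).property.2⟩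
    exact ⟨
      { pt := ⟨_, h⟩
        ι :=
          { app := fun a ↦ ObjectProperty.homMk ((liftCocone hc).ι.app a)
            naturality := fun a b f ↦ by
              ext1
              exact (liftCocone hc).ι.naturality f } }⟩

instance hasColimit_finRec_forget : HasColimit (finRecDiagram F κ ⋙ Coalgebra.forget F) := by
  have := hasColimitsOfShape_of_essentiallySmall.{w} (finRec F κ).FullSubcategory C
  infer_instance

instance hasColimit_finRec : HasColimit (finRecDiagram F κ) :=
  hasColimit_of_hasColimit_forget

variable {F κ}

lemma isCardinalPresentable_coprod {P Q : C} [IsCardinalPresentable P κ]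
    [IsCardinalPresentable Q κ] [HasBinaryCoproduct P Q] : IsCardinalPresentable (P ⨿ Q) κ := by
  have (k : Discrete WalkingPair) : IsCardinalPresentable ((pair P Q).obj k) κ := by
    rcases k with ⟨_ | _⟩ <;> assumption
  exact isCardinalPresentable_of_isColimit _ (coprodIsCoprod P Q) κ
    (hasCardinalLT_of_finite _ _ (Cardinal.IsRegular.aleph0_le Fact.out))

lemma isCardinalPresentable_coequalizer {P Q : C} [IsCardinalPresentable P κ]
    [IsCardinalPresentable Q κ] (f g : P ⟶ Q) [HasCoequalizer f g] :
    IsCardinalPresentable (coequalizer f g) κ := by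
  have (k : WalkingParallelPair) : IsCardinalPresentable ((parallelPair f g).obj k) κ := by
    rcases k with _ | _ <;> assumption
  exact isCardinalPresentable_of_isColimit _ (coequalizerIsCoequalizer f g) κ
    (hasCardinalLT_of_finite _ _ (Cardinal.IsRegular.aleph0_le Fact.out))

variable {c : Cocone (finRecDiagram F κ)}
  (hc : IsColimit ((Coalgebra.forget F).mapCocone c))

include hc

variable [F.IsCardinalAccessible κ]

lemma exists_lift_comp_str {P : C} [IsCardinalPresentable P κ] (p : P ⟶ F.obj c.pt.V) :
    ∃ x : P ⟶ c.pt.V, x ≫ c.pt.str = p := by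
  have := F.preservesColimitsOfShape_of_isCardinalAccessible_of_essentiallySmall κ
    (finRec F κ).FullSubcategory
  have := hasFiniteColimits_of_hasColimitsOfSize C
  obtain ⟨R, p', rfl⟩ := IsCardinalPresentable.exists_hom_of_isColimit κ
    (isColimitOfPreserves F hc) p
  change P ⟶ F.obj R.obj.V at p'
  have := R.property.1
  -- The summand P has structure `p'`, so its coprojection to the colimit is the required lift.
  let S : (finRec F κ).FullSubcategory :=
    ⟨coprodCoalgebra R.obj p', isCardinalPresentable_coprod, R.property.2.coprodCoalgebra p'⟩
  let i : R ⟶ S := ObjectProperty.homMk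
    { f := coprod.inr
      h := by
        change R.obj.str ≫ F.map coprod.inr =
          coprod.inr ≫ coprod.desc p' R.obj.str ≫ F.map coprod.inr
        rw [coprod.inr_desc_assoc] }
  refine ⟨coprod.inl ≫ (c.ι.app S).f, ?_⟩
  have h₁ : (c.ι.app S).f ≫ c.pt.str = _ := (c.ι.app S).h.symm
  have h₂ : coprod.inr ≫ (c.ι.app S).f = (c.ι.app R).f := congr_arg Coalgebra.Hom.f (c.w i)
  rw [Category.assoc, h₁]
  change coprod.inl ≫ (coprod.desc p' R.obj.str ≫ F.map coprod.inr) ≫ F.map (c.ι.app S).f =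
    p' ≫ F.map (c.ι.app R).f
  rw [← h₂, Category.assoc, coprod.inl_desc_assoc, F.map_comp]

lemma comp_str_injective {P : C} [IsCardinalPresentable P κ] {x y : P ⟶ c.pt.V}
    (h : x ≫ c.pt.str = y ≫ c.pt.str) : x = y := by
  have := F.preservesColimitsOfShape_of_isCardinalAccessible_of_essentiallySmall κ
    (finRec F κ).FullSubcategory
  have := isFiltered_of_isCardinalFiltered (finRec F κ).FullSubcategory κ
  have := hasFiniteColimits_of_hasColimitsOfSize C
  obtain ⟨R₁, x, rfl⟩ := IsCardinalPresentable.exists_hom_of_isColimit κ hc x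
  obtain ⟨R₂, y, rfl⟩ := IsCardinalPresentable.exists_hom_of_isColimit κ hc y
  change P ⟶ R₁.obj.V at x
  change P ⟶ R₂.obj.V at y
  change (x ≫ (c.ι.app R₁).f) ≫ c.pt.str = (y ≫ (c.ι.app R₂).f) ≫ c.pt.str at h
  have h₁ : (c.ι.app R₁).f ≫ c.pt.str = R₁.obj.str ≫ F.map (c.ι.app R₁).f :=
    (c.ι.app R₁).h.symm
  have h₂ : (c.ι.app R₂).f ≫ c.pt.str = R₂.obj.str ≫ F.map (c.ι.app R₂).f :=
    (c.ι.app R₂).h.symm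
  rw [Category.assoc, Category.assoc, h₁, h₂, ← Category.assoc, ← Category.assoc] at h
  obtain ⟨R, a, b, hab⟩ := IsCardinalPresentable.exists_eq_of_isColimit κ
    (isColimitOfPreserves F hc) (x ≫ R₁.obj.str) (y ≫ R₂.obj.str) h
  change (x ≫ R₁.obj.str) ≫ F.map a.hom.f = (y ≫ R₂.obj.str) ≫ F.map b.hom.f at hab
  -- At this common stage the structure itself identifies the two maps, as the quotient coalgebra
  -- requires.
  have hR : (x ≫ a.hom.f) ≫ R.obj.str = (y ≫ b.hom.f) ≫ R.obj.str := by
    simpa using hab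
  have := R.property.1
  let S : (finRec F κ).FullSubcategory :=
    ⟨coequalizerCoalgebra R.obj hR, isCardinalPresentable_coequalizer _ _,
      R.property.2.coequalizerCoalgebra hR⟩
  let q : R ⟶ S := ObjectProperty.homMk
    { f := coequalizer.π _ _
      h := (coequalizer.π_desc_assoc _ _ _).symm }
  have ha : a.hom.f ≫ (c.ι.app R).f = (c.ι.app R₁).f := congr_arg Coalgebra.Hom.f (c.w a)
  have hb : b.hom.f ≫ (c.ι.app R).f = (c.ι.app R₂).f := congr_arg Coalgebra.Hom.f (c.w b)
  have hq : coequalizer.π _ _ ≫ (c.ι.app S).f = (c.ι.app R).f :=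
    congr_arg Coalgebra.Hom.f (c.w q)
  change x ≫ (c.ι.app R₁).f = y ≫ (c.ι.app R₂).f
  rw [← ha, ← hb, ← hq, ← Category.assoc, ← Category.assoc y]
  exact coequalizer.condition_assoc _ _ _

lemma isIso_str_of_isColimit : IsIso c.pt.str := by
  obtain ⟨P, _, hP⟩ := HasCardinalFilteredGenerator.exists_generator C κ
  refine isIso_of_bijective_comp hP.isStrongGenerator _ fun G hG ↦ ?_
  have : IsCardinalPresentable G κ := hP.le_isCardinalPresentable _ hG
  exact ⟨fun _ _ h ↦ comp_str_injective hc h, exists_lift_comp_str hc⟩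

end Presentable

lemma nonempty_isInitial_of_isColimit {κ : Cardinal.{w}} [Fact κ.IsRegular]
    {c : Cocone (finRecDiagram F κ)} (hc : IsColimit ((Coalgebra.forget F).mapCocone c))
    [IsIso c.pt.str] : Nonempty (IsInitial (algOfCoalg c.pt)) :=
  ⟨(isRecursive_of_isColimit hc fun R ↦ R.property.2).isInitial⟩

/-- An isomorphism between algebras with invertible structure is an isomorphism of coalgebras. -/
noncomputable def coalgIsoOfAlgIso {R : Coalgebra F} [IsIso R.str] {I : Algebra F} [IsIso I.str]
    (e : algOfCoalg R ≅ I) : R ≅ coalgOfAlg I :=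
  Coalgebra.isoMk ((Algebra.forget F).mapIso e) (by
    have h : F.map e.hom.f ≫ I.str = inv R.str ≫ e.hom.f := e.hom.h
    change R.str ≫ F.map e.hom.f = e.hom.f ≫ inv I.str
    rw [IsIso.eq_comp_inv, Category.assoc, h, IsIso.hom_inv_id_assoc])

lemma exists_isCardinalLocallyPresentable_isCardinalAccessible [IsLocallyPresentable.{w} C]
    (F : C ⥤ C) [F.IsAccessible.{w}] :
    ∃ (κ : Cardinal.{w}) (_ : Fact κ.IsRegular),
      IsCardinalLocallyPresentable C κ ∧ F.IsCardinalAccessible κ := by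
  obtain ⟨κ₁, _, _⟩ := IsLocallyPresentable.exists_cardinal.{w} C
  obtain ⟨κ₂, _, _⟩ := Functor.IsAccessible.exists_cardinal (F := F)
  rcases le_total κ₁ κ₂ with h | h
  · exact ⟨κ₂, inferInstance, IsCardinalLocallyPresentable.of_le C h, inferInstance⟩
  · exact ⟨κ₁, inferInstance, inferInstance, F.isCardinalAccessible_of_le h⟩

end RecCoalg

theorem mainTheorem2 {C : Type u} [Category.{v} C] [IsLocallyPresentable.{w} C]
    (F : C ⥤ C) [F.IsAccessible.{w}] :
    (∃ (κ : Cardinal.{w}) (_ : Fact κ.IsRegular),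
      IsCardinalLocallyPresentable C κ ∧ F.IsCardinalAccessible κ) ∧
    ∀ (κ : Cardinal.{w}) [Fact κ.IsRegular] [IsCardinalLocallyPresentable C κ]
      [F.IsCardinalAccessible κ],
      HasInitial (Algebra F) ∧
      HasColimit (RecCoalg.finRecDiagram F κ) ∧
      HasColimit (RecCoalg.finRecDiagram F κ ⋙ Coalgebra.forget F) ∧
      (∀ c : Cocone (RecCoalg.finRecDiagram F κ), Nonempty (IsColimit c) →
        Nonempty (IsColimit ((Coalgebra.forget F).mapCocone c)) ∧
        ∃ _ : IsIso c.pt.str, Nonempty (IsInitial (RecCoalg.algOfCoalg c.pt))) ∧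
      (∀ I : Algebra F, Nonempty (IsInitial I) →
        ∃ (_ : IsIso I.str)
          (ι : RecCoalg.finRecDiagram F κ ⟶
            (Functor.const _).obj (RecCoalg.coalgOfAlg I)),
          Nonempty (IsColimit (Cocone.mk _ ι)) ∧
          Nonempty (IsColimit ((Coalgebra.forget F).mapCocone (Cocone.mk _ ι)))) := by
  refine ⟨RecCoalg.exists_isCardinalLocallyPresentable_isCardinalAccessible F,
    fun κ _ _ _ ↦ ?_⟩
  let c := colimit.cocone (RecCoalg.finRecDiagram F κ)
  let hc : IsColimit c := colimit.isColimit _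
  obtain ⟨hc'⟩ := RecCoalg.nonempty_isColimit_forget hc
  have := RecCoalg.isIso_str_of_isColimit hc'
  obtain ⟨hi⟩ := RecCoalg.nonempty_isInitial_of_isColimit hc'
  refine ⟨hi.hasInitial, inferInstance, inferInstance, fun d ⟨hd⟩ ↦ ?_, fun I ⟨hI⟩ ↦ ?_⟩
  · obtain ⟨hd'⟩ := RecCoalg.nonempty_isColimit_forget hd
    have := RecCoalg.isIso_str_of_isColimit hd'
    exact ⟨⟨hd'⟩, this, RecCoalg.nonempty_isInitial_of_isColimit hd'⟩
  · have := Algebra.Initial.str_isIso hI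
    let e := RecCoalg.coalgIsoOfAlgIso (hi.uniqueUpToIso hI)
    -- Any initial algebra inherits the colimit cocone through its isomorphism with the one
    -- constructed.
    have he : IsColimit (c.extend e.hom) := hc.extendIso e.hom
    exact ⟨this, (c.extend e.hom).ι, ⟨he⟩, RecCoalg.nonempty_isColimit_forget he⟩
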